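/- Let $d\ge 2$, $n\ge 1$. Let $P$ be a probability measure supported on $[-1,1]^d$ and let $\rho_0$ be a probability measure on $\mathbb{R}^d\times\mathbb{R}$ with $\|\mathbf w\|_1+|b|\le 1$ for $\rho_0$-almost every $(\mathbf w,b)$. Let $\sigma(s)=\max(s,0)$. For $a\in L^2(\rho_0)$ put $V_a(\mathbf x)=\mathbb{E}_{\rho_0}[a(\mathbf w,b)\,\sigma(\mathbf w\cdot\mathbf x+b)]$. For a function $V$ let $\|V\|_{\mathcal H}=\inf\{\|a\|_{L^2(\rho_0)} : V=V_a \text{ on } [-1,1]^d\}$ (with $\inf\emptyset=\infty$). A potential $V$ generates the distribution $Q=e^{-V}P/\mathbb{E}_P[e^{-V}]$. Let $Q_*$ be generated by a potential $V_*$ with $\|V_*\|_{\mathcal H}<\infty$. Let $\mathbf x_1,\dots,\mathbf x_n$ be i.i.d. samples of $Q_*$, and let $$L^{(n)}(a)=\frac1n\sum_{i=1}^n V_a(\mathbf x_i)+\log\mathbb{E}_P[e^{-V_a}],\qquad a\in L^2(\rho_0).$$ Given $a_0\in L^2(\rho_0)$ (independent of the samples), let $a^{(n)}_t$, $t\ge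 0$, be the gradient flow $\frac{d}{dt}a^{(n)}_t=-\nabla L^{(n)}(a^{(n)}_t)$ in $L^2(\rho_0)$ with $a^{(n)}_0=a_0$. Let $V_0=V_{a_0}$, and let $Q^{(n)}_t$ be the distribution generated by $V_{a^{(n)}_t}$. Then for all $0<c_1\le c_2$ there is a constant $C=C(c_1,c_2)>0$, independent of $d,n,P,\rho_0,V_*,a_0$ and $\delta$, such that for every $\delta\in(0,1)$, with probability at least $1-\delta$ over the samples, for every early-stopping time $T$ with $$c_1\,\|V_*-V_0\|_{\mathcal H}\Big(\frac{n}{\log d}\Big)^{1/4}\le T\le c_2\,\|V_*-V_0\|_{\mathcal H}\Big(\frac{n}{\log d}\Big)^{1/4},$$ we have $$KL\big(Q_*\,\|\,Q^{(n)}_T\big)\le C\sqrt{\log(2/\delta)}\;\|V_*-V_0\|_{\mathcal H}\Big(\frac{\log d}{n}\Big)^{1/4}.$$ On the same event the same holds if $\|V_*-V_0\|_{\mathcal H}$ is replaced throughout by $\|a_*-a_0\|_{L^2(\rho_0)}$ for any $a_*\in L^2(\rho_0)$ with $V_{a_*}=V_*$ on $[-1,1]^d$. -/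

import Mathlib

open MeasureTheory Set
open scoped ENNReal

noncomputable section

/-- The ReLU activation. -/
def relu (s : ℝ) : ℝ := max s 0

/-- The cube `[-1,1]^d`. -/
def cube (d : ℕ) : Set (Fin d → ℝ) := {x | ∀ i, |x i| ≤ 1}

/-- Random feature model: the potential `V(x) = E_{(w,b) ∼ ρ₀}[a(w,b) σ(w·x + b)]`
with parameter function `a ∈ L²(ρ₀)` and ReLU activation `σ`. -/
def potential {d : ℕ} (ρ₀ : Measure ((Fin d → ℝ) × ℝ)) (a : Lp ℝ 2 ρ₀) (x : Fin d → ℝ) : ℝ :=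
  ∫ p, a p * relu ((∑ i, p.1 i * x i) + p.2) ∂ρ₀

/-- `a` is a parameter function of `V` as a function on the cube `[-1,1]^d`. -/
def Represents {d : ℕ} (ρ₀ : Measure ((Fin d → ℝ) × ℝ)) (a : Lp ℝ 2 ρ₀)
    (V : (Fin d → ℝ) → ℝ) : Prop :=
  ∀ x ∈ cube d, V x = potential ρ₀ a x

/-- The RKHS norm of `V` on the cube: the least `L²(ρ₀)` norm of a parameter function of `V`
(`∞` if there is none). -/
def rkhsNorm {d : ℕ} (ρ₀ : Measure ((Fin d → ℝ) × ℝ)) (V : (Fin d → ℝ) → ℝ) : ℝ≥0∞ :=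
  ⨅ (a : Lp ℝ 2 ρ₀) (_ : Represents ρ₀ a V), ‖a‖ₑ

/-- The distribution `Q = Z⁻¹ e^{-V} P`, `Z = E_P[e^{-V}]`, generated by the potential `V`
and the base distribution `P`. -/
def generated {d : ℕ} (P : Measure (Fin d → ℝ)) (V : (Fin d → ℝ) → ℝ) : Measure (Fin d → ℝ) :=
  P.tilted (fun x => -V x)

/-- The empirical loss `L^{(n)}(V) = E_{Q_*^{(n)}}[V] + log E_P[e^{-V}]` of the sample
`X₁, …, Xₙ`, as a function of the parameter function `a` of `V`. -/
def empiricalLoss {d n : ℕ} (P : Measure (Fin d → ℝ)) (ρ₀ : Measure ((Fin d → ℝ) × ℝ))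
    (X : Fin n → Fin d → ℝ) (a : Lp ℝ 2 ρ₀) : ℝ :=
  (∑ i, potential ρ₀ a (X i)) / n + Real.log (∫ x, Real.exp (-potential ρ₀ a x) ∂P)

/-- `y : [0,∞) → H` is a trajectory of the gradient flow `dy/dt = -∇L(y)`
(values of `y` at negative times play no role). -/
def IsGradientFlow {H : Type*} [NormedAddCommGroup H] [InnerProductSpace ℝ H] [CompleteSpace H]
    (L : H → ℝ) (y : ℝ → H) : Prop :=
  ∀ t : ℝ, 0 ≤ t → ∃ g : H, HasGradientAt L g (y t) ∧ HasDerivWithinAt y (-g) (Ici 0) t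

end

/-! With φ(x) ∈ L²(ρ₀) the ReLU feature at x, V_a(x) = ⟪φ(x), a⟫ and ‖φ(x)‖ ≤ 1 on the cube. The
loss is ⟪m, a⟫ + log E_P[e^{-⟪φ, a⟫}], m being the empirical feature mean, so it is convex. With the
mean m_* under Q_* instead of m, its excess over a_* is exactly KL(Q_*‖Q_a).

Convexity makes t(L(a_t) - L(a_*)) + ‖a_t - a_*‖²/2 nonincreasing (`IsGradientFlow.mul_sub_add_le`).
The two losses differ by a linear term, which Young's inequality absorbs into ‖a_T - a_*‖²/(2T), so
KL ≤ ‖a_* - a_0‖²/(2T) + T‖m - m_*‖²/2 (`klDiv_gradientFlow_le`).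

A dimension-free Hilbert-space bound (`measure_norm_empirical_sub_mean_sq_gt_le`) gives ‖m - m_*‖² ≲
√(log(2/δ))/√n. This is weaker than the optimal 1/n, but suffices for T of order n^{1/4}. Since log
d ≥ log 2, the factor log d costs only a constant. -/

/-! ### Gibbs measures: log-partition function and KL divergence. -/

section Tilted

variable {X : Type*} [MeasurableSpace X] {P : Measure X} {f g : X → ℝ} {c : ℝ}

lemma integrable_exp_of_abs_le [IsFiniteMeasure P] (hf : AEStronglyMeasurable f P)
    (hfc : ∀ᵐ x ∂P, |f x| ≤ c) : Integrable (fun x => Real.exp (f x)) P := by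
  refine Integrable.of_bound (Real.continuous_exp.comp_aestronglyMeasurable hf) (Real.exp c) ?_
  filter_upwards [hfc] with x hx
  rw [Real.norm_eq_abs, Real.abs_exp]
  exact Real.exp_le_exp.2 ((le_abs_self _).trans hx)

/-- The Gibbs variational inequality for the log-partition function. -/
lemma log_integral_exp_ge [IsProbabilityMeasure P] (hf : AEStronglyMeasurable f P)
    (hg : AEStronglyMeasurable g P) (hfc : ∀ᵐ x ∂P, |f x| ≤ c) (hgc : ∀ᵐ x ∂P, |g x| ≤ c) :
    Real.log (∫ x, Real.exp (f x) ∂P) + ∫ x, (g x - f x) ∂(P.tilted f) ≤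
      Real.log (∫ x, Real.exp (g x) ∂P) := by
  have hef := integrable_exp_of_abs_le hf hfc
  have heg := integrable_exp_of_abs_le hg hgc
  have hac := tilted_absolutelyContinuous P f
  have := isProbabilityMeasure_tilted hef
  have hfg : AEStronglyMeasurable (fun x => g x - f x) (P.tilted f) := (hg.sub hf).mono_ac hac
  have hfgc : ∀ᵐ x ∂(P.tilted f), |g x - f x| ≤ c + c := by
    filter_upwards [hac hfc, hac hgc] with x h1 h2
    exact (abs_sub _ _).trans (add_le_add h2 h1)
  have hJ := convexOn_exp.map_integral_le (μ := P.tilted f) (f := fun x => g x - f x)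
    Real.continuous_exp.continuousOn isClosed_univ (by simp)
    (Integrable.of_bound hfg (c + c) hfgc) (integrable_exp_of_abs_le hfg hfgc)
  have hI : ∫ x, Real.exp (g x - f x) ∂(P.tilted f) =
      (∫ x, Real.exp (g x) ∂P) / ∫ x, Real.exp (f x) ∂P := by
    have := integral_exp_tilted (μ := P) f (g - f)
    simpa using this
  simp only [hI] at hJ
  have h := Real.log_le_log (Real.exp_pos _) hJ
  rw [Real.log_exp, Real.log_div (integral_exp_pos heg).ne' (integral_exp_pos hef).ne'] at h
  linarith

/-- The log-likelihood ratio is f - g plus a constant. For f, g linear in the parameter, the result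
is an excess population loss. -/
lemma klDiv_tilted_tilted [IsProbabilityMeasure P] (hf : AEStronglyMeasurable f P)
    (hg : AEStronglyMeasurable g P) (hfc : ∀ᵐ x ∂P, |f x| ≤ c) (hgc : ∀ᵐ x ∂P, |g x| ≤ c) :
    InformationTheory.klDiv (P.tilted f) (P.tilted g) =
      ENNReal.ofReal (∫ x, (f x - g x) ∂(P.tilted f) +
        Real.log (∫ x, Real.exp (g x) ∂P) - Real.log (∫ x, Real.exp (f x) ∂P)) := by
  have hef := integrable_exp_of_abs_le hf hfc
  have heg := integrable_exp_of_abs_le hg hgc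
  have hacf := tilted_absolutelyContinuous P f
  have := isProbabilityMeasure_tilted hef
  have := isProbabilityMeasure_tilted heg
  have hfg : Integrable (fun x => f x - g x) (P.tilted f) := by
    refine Integrable.of_bound ((hf.sub hg).mono_ac hacf) (c + c) ?_
    filter_upwards [hacf hfc, hacf hgc] with x h1 h2
    exact (abs_sub _ _).trans (add_le_add h1 h2)
  have hac : P.tilted f ≪ P.tilted g := hacf.trans (absolutelyContinuous_tilted heg)
  have hllr : llr (P.tilted f) (P.tilted g) =ᵐ[P.tilted f] fun x => (f x - g x) +
      (Real.log (∫ x, Real.exp (g x) ∂P) - Real.log (∫ x, Real.exp (f x) ∂P)) := by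
    filter_upwards [llr_tilted_right hacf heg, hacf (log_rnDeriv_tilted_left_self hef)]
      with x h1 h2
    rw [h1, llr, h2]
    ring
  rw [InformationTheory.klDiv_of_ac_of_integrable hac
    ((integrable_congr hllr).2 (hfg.add (integrable_const _))), integral_congr_ae hllr,
    integral_add hfg (integrable_const _)]
  simp [add_sub_assoc]

end Tilted

/-! ### Convex gradient flow. -/

section GradientFlow

variable {H : Type*} [NormedAddCommGroup H] [InnerProductSpace ℝ H] [CompleteSpace H]

/-- L minus its affine minorant is minimal at a. This identifies the flow's velocity without
differentiating the log-partition function. -/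
lemma eq_gradient_of_forall_add_inner_le {L : H → ℝ} {a g g' : H}
    (hsub : ∀ b, L a + inner ℝ g' (b - a) ≤ L b) (hg : HasGradientAt L g a) : g = g' := by
  have h1 : HasFDerivAt (fun b => L b - innerSL ℝ g' b)
      (InnerProductSpace.toDual ℝ H g - innerSL ℝ g') a :=
    hg.hasFDerivAt.sub (innerSL ℝ g').hasFDerivAt
  have hmin : IsLocalMin (fun b => L b - innerSL ℝ g' b) a :=
    Filter.Eventually.of_forall fun b => by
      have := hsub b
      rw [inner_sub_right] at this
      simp only [innerSL_apply_apply]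
      linarith
  have h0 := hmin.hasFDerivAt_eq_zero h1
  refine ext_inner_right ℝ fun v => ?_
  have := congrArg (fun l => l v) h0
  simp only [sub_apply, InnerProductSpace.toDual_apply_apply,
    innerSL_apply_apply, zero_apply] at this
  linarith

/-- The standard Lyapunov estimate for the gradient flow of a loss with global subgradients. -/
lemma IsGradientFlow.mul_sub_add_le {L : H → ℝ} {y : ℝ → H} (hy : IsGradientFlow L y)
    (hsub : ∀ a, ∃ g', ∀ b, L a + inner ℝ g' (b - a) ≤ L b) (z : H) {T : ℝ} (hT : 0 ≤ T) :
    T * (L (y T) - L z) + ‖y T - z‖ ^ 2 / 2 ≤ ‖y 0 - z‖ ^ 2 / 2 := by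
  choose! g hg hyg using hy
  have hD : ∀ t ∈ Ici (0 : ℝ), HasDerivWithinAt
      (fun t => t * (L (y t) - L z) + ‖y t - z‖ ^ 2 / 2)
      ((1 * (L (y t) - L z) + t * (inner ℝ (g t) (-g t))) +
        (2 * inner ℝ (y t - z) (-g t)) / 2) (Ici 0) t := by
    intro t ht
    have hL : HasDerivWithinAt (fun t => L (y t)) (inner ℝ (g t) (-g t)) (Ici 0) t := by
      have h := (hg t ht).hasFDerivAt.comp_hasDerivWithinAt t (hyg t ht)
      rw [InnerProductSpace.toDual_apply_apply] at h
      exact h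
    exact ((hasDerivWithinAt_id t _).mul (hL.sub_const _)).add
      (((hyg t ht).sub_const z).norm_sq.div_const 2)
  have hanti : AntitoneOn (fun t => t * (L (y t) - L z) + ‖y t - z‖ ^ 2 / 2) (Ici (0 : ℝ)) := by
    refine antitoneOn_of_hasDerivWithinAt_nonpos (convex_Ici 0)
      (fun t ht => (hD t ht).continuousWithinAt)
      (fun t ht => (hD t (interior_subset ht)).mono interior_subset) ?_
    intro t ht
    have ht : 0 ≤ t := interior_subset ht
    -- The derivative is L(y) - L(z) + ⟪g, z - y⟫ - t‖g‖²; the subgradient inequality makes the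
    -- first three terms nonpositive.
    obtain ⟨g', hg'⟩ := hsub (y t)
    have h1 := hg' z
    rw [← eq_gradient_of_forall_add_inner_le hg' (hg t ht)] at h1
    have h2 : inner ℝ (y t - z) (-g t) = inner ℝ (g t) (z - y t) := by
      rw [inner_neg_right, real_inner_comm, ← inner_neg_right, neg_sub]
    have h3 : 0 ≤ t * inner ℝ (g t) (g t) := mul_nonneg ht real_inner_self_nonneg
    rw [h2, inner_neg_right]
    linarith
  simpa using hanti self_mem_Ici hT hT

end GradientFlow

/-! ### Concentration of Hilbert-space valued means. -/

section Concentration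

variable {X H : Type*} [MeasurableSpace X] [NormedAddCommGroup H] [InnerProductSpace ℝ H]
  [CompleteSpace H] {μ : Measure X} [IsProbabilityMeasure μ] {ψ : X → H} {B : ℝ}

/-- One more sample is added to a partial sum S. In the expanded square, the cross term 2l⟪S, ψ⟫ is
centred and bounded, so Hoeffding's lemma controls its exponential moment. -/
lemma lintegral_exp_mul_norm_add_sq_le (hψ : StronglyMeasurable ψ) (hB : ∀ᵐ x ∂μ, ‖ψ x‖ ≤ B)
    (h0 : ∫ x, ψ x ∂μ = 0) {l : ℝ} (hl : 0 ≤ l) (S : H) :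
    ∫⁻ x, ENNReal.ofReal (Real.exp (l * ‖ψ x + S‖ ^ 2)) ∂μ ≤
      ENNReal.ofReal (Real.exp (l * B ^ 2 + 2 * l ^ 2 * B ^ 2 * ‖S‖ ^ 2) *
        Real.exp (l * ‖S‖ ^ 2)) := by
  have hY : ∀ᵐ x ∂μ, inner ℝ S (ψ x) ∈ Icc (-(‖S‖ * B)) (‖S‖ * B) := by
    filter_upwards [hB] with x hx
    exact abs_le.1 ((abs_real_inner_le_norm _ _).trans
      (mul_le_mul_of_nonneg_left hx (norm_nonneg _)))
  have hψi : Integrable ψ μ := Integrable.of_bound hψ.aestronglyMeasurable B hB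
  have hmean : ∫ x, inner ℝ S (ψ x) ∂μ = 0 := by
    rw [integral_inner hψi, h0, inner_zero_right]
  have hYm : AEMeasurable (fun x => inner ℝ S (ψ x)) μ :=
    (stronglyMeasurable_const.inner hψ).measurable.aemeasurable
  have hsub := ProbabilityTheory.hasSubgaussianMGF_of_mem_Icc_of_integral_eq_zero hYm hY hmean
  have hmgf := hsub.mgf_le (2 * l)
  have hint := hsub.integrable_exp_mul (2 * l)
  have hconst : (((‖‖S‖ * B - -(‖S‖ * B)‖₊ / 2) ^ 2 : NNReal) : ℝ) * (2 * l) ^ 2 / 2 =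
      2 * l ^ 2 * B ^ 2 * ‖S‖ ^ 2 := by
    push_cast
    rw [div_pow, Real.norm_eq_abs, sq_abs]
    ring
  rw [hconst, ProbabilityTheory.mgf] at hmgf
  calc ∫⁻ x, ENNReal.ofReal (Real.exp (l * ‖ψ x + S‖ ^ 2)) ∂μ
      ≤ ∫⁻ x, ENNReal.ofReal (Real.exp (l * B ^ 2 + l * ‖S‖ ^ 2) *
          Real.exp (2 * l * inner ℝ S (ψ x))) ∂μ := by
        refine lintegral_mono_ae ?_
        filter_upwards [hB] with x hx
        refine ENNReal.ofReal_le_ofReal ?_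
        rw [← Real.exp_add, Real.exp_le_exp, norm_add_sq_real, real_inner_comm]
        have h1 : l * ‖ψ x‖ ^ 2 ≤ l * B ^ 2 :=
          mul_le_mul_of_nonneg_left (pow_le_pow_left₀ (norm_nonneg _) hx 2) hl
        linarith
    _ = ENNReal.ofReal (Real.exp (l * B ^ 2 + l * ‖S‖ ^ 2) *
          ∫ x, Real.exp (2 * l * inner ℝ S (ψ x)) ∂μ) := by
        rw [← integral_const_mul, ofReal_integral_eq_lintegral_ofReal (hint.const_mul _)]
        exact Filter.Eventually.of_forall fun x => by positivity
    _ ≤ _ := by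
        refine ENNReal.ofReal_le_ofReal
          ((mul_le_mul_of_nonneg_left hmgf (Real.exp_pos _).le).trans_eq ?_)
        simp only [← Real.exp_add]
        ring_nf

lemma ae_pi_forall {ι : Type*} [Fintype ι] {p : X → Prop} (hp : ∀ᵐ x ∂μ, p x) :
    ∀ᵐ x ∂(Measure.pi fun _ : ι => μ), ∀ i, p (x i) :=
  ae_all_iff.2 fun i =>
    (measurePreserving_eval (fun _ : ι => μ) i).quasiMeasurePreserving.ae hp

lemma lintegral_exp_mul_norm_sum_sq_le (hψ : StronglyMeasurable ψ) (hB : ∀ᵐ x ∂μ, ‖ψ x‖ ≤ B)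
    (h0 : ∫ x, ψ x ∂μ = 0) {l : ℝ} (hl : 0 ≤ l) (n k : ℕ) (hk : k ≤ n) :
    ∫⁻ x, ENNReal.ofReal (Real.exp (l * ‖∑ i, ψ (x i)‖ ^ 2))
        ∂(Measure.pi fun _ : Fin k => μ) ≤
      ENNReal.ofReal (Real.exp (k * (l * B ^ 2 + 2 * l ^ 2 * B ^ 2 * (n * B) ^ 2))) := by
  induction k with
  | zero => simp
  | succ k ih =>
    have hmp := measurePreserving_piFinSuccAbove (fun _ : Fin (k + 1) => μ) 0
    have hS : StronglyMeasurable fun x : Fin k → X => ∑ i, ψ (x i) :=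
      Finset.stronglyMeasurable_fun_sum _ fun i _ => hψ.comp_measurable (measurable_pi_apply i)
    have hF : Measurable fun p : X × (Fin k → X) =>
        ENNReal.ofReal (Real.exp (l * ‖ψ p.1 + ∑ i, ψ (p.2 i)‖ ^ 2)) :=
      ((((hψ.comp_measurable measurable_fst).add
        (hS.comp_measurable measurable_snd)).norm.measurable.pow_const 2).const_mul
          l).exp.ennreal_ofReal
    -- This crude bound makes the growth factor the same at each step; it is affordable for l of
    -- order n^{-3/2}.
    have hstep : ∀ᵐ x ∂(Measure.pi fun _ : Fin k => μ), ‖∑ i, ψ (x i)‖ ≤ n * B := by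
      have hB0 : 0 ≤ B := by
        obtain ⟨x, hx⟩ := hB.exists
        exact (norm_nonneg _).trans hx
      filter_upwards [ae_pi_forall (ι := Fin k) hB] with x hx
      calc ‖∑ i, ψ (x i)‖ ≤ ∑ _i : Fin k, B := norm_sum_le_of_le _ fun i _ => hx i
        _ = k * B := by simp
        _ ≤ n * B := by gcongr; omega
    calc _ = ∫⁻ p, ENNReal.ofReal (Real.exp (l * ‖ψ p.1 + ∑ i, ψ (p.2 i)‖ ^ 2))
          ∂(μ.prod (Measure.pi fun _ : Fin k => μ)) := by
          rw [← hmp.lintegral_comp hF]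
          refine lintegral_congr fun x => ?_
          rw [Fin.sum_univ_succ]
          rfl
      _ = ∫⁻ y, ∫⁻ x, ENNReal.ofReal (Real.exp (l * ‖ψ x + ∑ i, ψ (y i)‖ ^ 2)) ∂μ
          ∂(Measure.pi fun _ : Fin k => μ) := lintegral_prod_symm' _ hF
      _ ≤ ∫⁻ y, ENNReal.ofReal (Real.exp (l * B ^ 2 + 2 * l ^ 2 * B ^ 2 * (n * B) ^ 2)) *
          ENNReal.ofReal (Real.exp (l * ‖∑ i, ψ (y i)‖ ^ 2))
          ∂(Measure.pi fun _ : Fin k => μ) := by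
          refine lintegral_mono_ae ?_
          filter_upwards [hstep] with y hy
          refine (lintegral_exp_mul_norm_add_sq_le hψ hB h0 hl _).trans ?_
          rw [← ENNReal.ofReal_mul (Real.exp_pos _).le]
          gcongr
      _ ≤ ENNReal.ofReal (Real.exp (l * B ^ 2 + 2 * l ^ 2 * B ^ 2 * (n * B) ^ 2)) *
          ENNReal.ofReal (Real.exp (k * (l * B ^ 2 + 2 * l ^ 2 * B ^ 2 * (n * B) ^ 2))) := by
          rw [lintegral_const_mul' _ _ ENNReal.ofReal_ne_top]
          gcongr
          exact ih (by omega)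
      _ = _ := by
          rw [← ENNReal.ofReal_mul (Real.exp_pos _).le, ← Real.exp_add]
          push_cast
          ring_nf

/-- Concentration of the empirical mean of a bounded Hilbert-space valued map. -/
lemma measure_norm_empirical_sub_mean_sq_gt_le {φ : X → H} (hφ : StronglyMeasurable φ)
    (h1 : ∀ᵐ x ∂μ, ‖φ x‖ ≤ 1) {n : ℕ} (hn : 1 ≤ n) {δ : ℝ} (hδ : 0 < δ) (hδ1 : δ < 1) :
    (Measure.pi fun _ : Fin n => μ) {x | 32 * √(Real.log (2 / δ)) / √n <
        ‖(n : ℝ)⁻¹ • ∑ i, φ (x i) - ∫ y, φ y ∂μ‖ ^ 2} ≤ ENNReal.ofReal δ := by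
  set m := ∫ y, φ y ∂μ
  have hφi : Integrable φ μ := Integrable.of_bound hφ.aestronglyMeasurable 1 h1
  have hm : ‖m‖ ≤ 1 := by
    simpa using norm_integral_le_of_norm_le_const h1
  have hψ : StronglyMeasurable fun x => φ x - m := hφ.sub stronglyMeasurable_const
  have hB : ∀ᵐ x ∂μ, ‖φ x - m‖ ≤ 2 := by
    filter_upwards [h1] with x hx
    exact (norm_sub_le _ _).trans (by linarith)
  have h0 : ∫ x, (φ x - m) ∂μ = 0 := by
    rw [integral_sub hφi (integrable_const _)]
    simp [m]
  set q := √(Real.log (2 / δ))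
  have hlog : Real.log 2 ≤ Real.log (2 / δ) :=
    Real.log_le_log (by norm_num) ((le_div_iff₀ hδ).2 (by linarith))
  have hlog2 := Real.log_two_gt_d9
  have hq2 : q ^ 2 = Real.log (2 / δ) := Real.sq_sqrt (by linarith)
  have hq : 1 / 2 ≤ q := Real.le_sqrt_of_sq_le (by linarith)
  have hn1 : (1 : ℝ) ≤ n := by exact_mod_cast hn
  have hn0 : (0 : ℝ) < n := by linarith
  set r := √(n : ℝ)
  have hr2 : r ^ 2 = n := Real.sq_sqrt hn0.le
  have hr : 1 ≤ r := Real.one_le_sqrt.2 hn1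
  have hr0 : 0 < r := by linarith
  -- With B = 2, this choice makes the moment exponent 2q/r + 8q², against 16q² from Markov's
  -- inequality at the threshold.
  set l := q / (2 * r ^ 3)
  have hl : 0 ≤ l := by positivity
  have key := lintegral_exp_mul_norm_sum_sq_le hψ hB h0 hl n n le_rfl
  have hsub : {x : Fin n → X | 32 * q / r < ‖(n : ℝ)⁻¹ • ∑ i, φ (x i) - m‖ ^ 2} ⊆
      {x | ENNReal.ofReal (Real.exp (16 * q ^ 2)) ≤
        ENNReal.ofReal (Real.exp (l * ‖∑ i, (φ (x i) - m)‖ ^ 2))} := by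
    intro x hx
    refine ENNReal.ofReal_le_ofReal (Real.exp_le_exp.2 ?_)
    have hx : 32 * q / r < ‖(n : ℝ)⁻¹ • ∑ i, φ (x i) - m‖ ^ 2 := hx
    have he : (n : ℝ)⁻¹ • ∑ i, φ (x i) - m = (n : ℝ)⁻¹ • ∑ i, (φ (x i) - m) := by
      rw [Finset.sum_sub_distrib, smul_sub, Finset.sum_const, Finset.card_univ, Fintype.card_fin,
        ← Nat.cast_smul_eq_nsmul ℝ, inv_smul_smul₀ hn0.ne']
    rw [he, norm_smul, mul_pow, norm_inv, Real.norm_of_nonneg hn0.le, inv_pow, ← hr2,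
      lt_inv_mul_iff₀ (by positivity)] at hx
    calc 16 * q ^ 2 = l * ((r ^ 2) ^ 2 * (32 * q / r)) := by
          simp only [l]
          field_simp
          norm_num
      _ ≤ _ := mul_le_mul_of_nonneg_left hx.le hl
  refine (measure_mono hsub).trans ?_
  have hmeas : AEMeasurable (fun x : Fin n → X =>
      ENNReal.ofReal (Real.exp (l * ‖∑ i, (φ (x i) - m)‖ ^ 2)))
      (Measure.pi fun _ : Fin n => μ) :=
    ((((Finset.stronglyMeasurable_fun_sum _ fun i _ => hψ.comp_measurable
      (measurable_pi_apply i)).norm.measurable.pow_const 2).const_mul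
        l).exp.ennreal_ofReal).aemeasurable
  refine (meas_ge_le_lintegral_div hmeas (by simp [Real.exp_pos])
    ENNReal.ofReal_ne_top).trans ?_
  refine (ENNReal.div_le_div_right key _).trans ?_
  rw [← ENNReal.ofReal_div_of_pos (Real.exp_pos _), ← Real.exp_sub]
  refine ENNReal.ofReal_le_ofReal ?_
  have hexp : n * (l * 2 ^ 2 + 2 * l ^ 2 * 2 ^ 2 * (n * 2) ^ 2) - 16 * q ^ 2 =
      2 * q / r - 8 * q ^ 2 := by
    simp only [l]
    rw [← hr2]
    field_simp
    ring
  have h2 : 2 * q / r ≤ 2 * q := div_le_self (by linarith) hr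
  rw [hexp]
  -- q ≥ 1/2 gives 2q ≤ 7q².
  calc Real.exp (2 * q / r - 8 * q ^ 2) ≤ Real.exp (-Real.log (2 / δ)) := by
        rw [← hq2]
        exact Real.exp_le_exp.2 (by nlinarith)
    _ = δ / 2 := by rw [Real.exp_neg, Real.exp_log (by positivity), inv_div]
    _ ≤ δ := by linarith

end Concentration

/-! ### KL bound for abstract bounded features. -/

section RandomFeature

lemma ae_abs_neg_inner_le {X H : Type*} [MeasurableSpace X] [NormedAddCommGroup H]
    [InnerProductSpace ℝ H] {P : Measure X} {φ : X → H} (h1 : ∀ᵐ x ∂P, ‖φ x‖ ≤ 1) (a : H) :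
    ∀ᵐ x ∂P, |-inner ℝ (φ x) a| ≤ ‖a‖ := by
  filter_upwards [h1] with x hx
  rw [abs_neg]
  exact (abs_real_inner_le_norm _ _).trans (mul_le_of_le_one_left (norm_nonneg _) hx)

variable {X H : Type*} [MeasurableSpace X] [NormedAddCommGroup H] [InnerProductSpace ℝ H]
  [CompleteSpace H] {P : Measure X} [IsProbabilityMeasure P] {φ : X → H}

/-- The subgradient inequality for the loss `a ↦ ⟪m, a⟫ + log E_P[e^{-⟪φ, a⟫}]`. -/
lemma loss_subgradient (hφ : StronglyMeasurable φ) (h1 : ∀ᵐ x ∂P, ‖φ x‖ ≤ 1) (m a b : H) :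
    inner ℝ m a + Real.log (∫ x, Real.exp (-inner ℝ (φ x) a) ∂P) +
        inner ℝ (m - ∫ x, φ x ∂(P.tilted fun x => -inner ℝ (φ x) a)) (b - a) ≤
      inner ℝ m b + Real.log (∫ x, Real.exp (-inner ℝ (φ x) b) ∂P) := by
  have hm (c : H) : AEStronglyMeasurable (fun x => -inner ℝ (φ x) c) P :=
    (hφ.inner stronglyMeasurable_const).neg.aestronglyMeasurable
  have ha := (ae_abs_neg_inner_le h1 a).mono fun x h => h.trans (le_max_left _ ‖b‖)
  have hb := (ae_abs_neg_inner_le h1 b).mono fun x h => h.trans (le_max_right ‖a‖ _)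
  have hG := log_integral_exp_ge (hm a) (hm b) ha hb
  have := isProbabilityMeasure_tilted (integrable_exp_of_abs_le (hm a) ha)
  have hφi : Integrable φ (P.tilted fun x => -inner ℝ (φ x) a) :=
    Integrable.of_bound hφ.aestronglyMeasurable 1 (tilted_absolutelyContinuous _ _ h1)
  have hI : ∫ x, (-inner ℝ (φ x) b - -inner ℝ (φ x) a)
      ∂(P.tilted fun x => -inner ℝ (φ x) a) =
      -inner ℝ (∫ x, φ x ∂(P.tilted fun x => -inner ℝ (φ x) a)) (b - a) := by
    rw [real_inner_comm, ← integral_inner hφi, ← integral_neg]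
    refine integral_congr_ae (Filter.Eventually.of_forall fun x => ?_)
    simp only [real_inner_comm (φ x), inner_sub_right]
    ring
  rw [hI] at hG
  rw [inner_sub_left, inner_sub_right m b a]
  linarith

/-- The KL divergence of the gradient flow from the target, in terms of the stopping time and of
the error of the empirical mean of the features. -/
lemma klDiv_gradientFlow_le (hφ : StronglyMeasurable φ) (h1 : ∀ᵐ x ∂P, ‖φ x‖ ≤ 1) (m as : H)
    {y : ℝ → H} (hy : IsGradientFlow
      (fun a => inner ℝ m a + Real.log (∫ x, Real.exp (-inner ℝ (φ x) a) ∂P)) y)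
    {T : ℝ} (hT : 0 < T) :
    InformationTheory.klDiv (P.tilted fun x => -inner ℝ (φ x) as)
        (P.tilted fun x => -inner ℝ (φ x) (y T)) ≤
      ENNReal.ofReal (‖as - y 0‖ ^ 2 / (2 * T) +
        T * ‖m - ∫ x, φ x ∂(P.tilted fun x => -inner ℝ (φ x) as)‖ ^ 2 / 2) := by
  have hm (c : H) : AEStronglyMeasurable (fun x => -inner ℝ (φ x) c) P :=
    (hφ.inner stronglyMeasurable_const).neg.aestronglyMeasurable
  have ha := (ae_abs_neg_inner_le h1 as).mono fun x h => h.trans (le_max_left _ ‖y T‖)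
  have hb := (ae_abs_neg_inner_le h1 (y T)).mono fun x h => h.trans (le_max_right ‖as‖ _)
  have := isProbabilityMeasure_tilted (integrable_exp_of_abs_le (hm as) ha)
  have hφi : Integrable φ (P.tilted fun x => -inner ℝ (φ x) as) :=
    Integrable.of_bound hφ.aestronglyMeasurable 1 (tilted_absolutelyContinuous _ _ h1)
  rw [klDiv_tilted_tilted (hm as) (hm (y T)) ha hb]
  refine ENNReal.ofReal_le_ofReal ?_
  set ms := ∫ x, φ x ∂(P.tilted fun x => -inner ℝ (φ x) as)
  have hI : ∫ x, (-inner ℝ (φ x) as - -inner ℝ (φ x) (y T))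
      ∂(P.tilted fun x => -inner ℝ (φ x) as) = inner ℝ ms (y T - as) := by
    rw [real_inner_comm, ← integral_inner hφi]
    refine integral_congr_ae (Filter.Eventually.of_forall fun x => ?_)
    simp only [real_inner_comm (φ x), inner_sub_right]
    ring
  rw [hI]
  have hflow := hy.mul_sub_add_le (fun a => ⟨_, fun b => loss_subgradient hφ h1 m a b⟩) as hT.le
  have hcs := real_inner_le_norm (ms - m) (y T - as)
  rw [norm_sub_rev ms m, inner_sub_left, inner_sub_right m] at hcs
  rw [norm_sub_rev (y 0) as] at hflow
  set D := inner ℝ m (y T) + Real.log (∫ x, Real.exp (-inner ℝ (φ x) (y T)) ∂P) -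
    (inner ℝ m as + Real.log (∫ x, Real.exp (-inner ℝ (φ x) as) ∂P))
  set e := ‖m - ms‖
  set s := ‖y T - as‖
  have hs : ‖as - y 0‖ ^ 2 / (2 * T) ≥ D + s ^ 2 / (2 * T) := by
    rw [ge_iff_le, ← sub_nonneg]
    have : ‖as - y 0‖ ^ 2 / (2 * T) - (D + s ^ 2 / (2 * T)) =
        (‖as - y 0‖ ^ 2 / 2 - (T * D + s ^ 2 / 2)) / T := by
      field_simp
    rw [this]
    exact div_nonneg (sub_nonneg.2 hflow) hT.le
  -- The weight is chosen so that s²/(2T) cancels against the Lyapunov estimate.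
  have hyoung : e * s ≤ s ^ 2 / (2 * T) + T * e ^ 2 / 2 := by
    rw [← sub_nonneg]
    have : s ^ 2 / (2 * T) + T * e ^ 2 / 2 - e * s = (s - T * e) ^ 2 / (2 * T) := by
      field_simp
      ring
    rw [this]
    positivity
  linarith

end RandomFeature

/-! ### ReLU features and the RKHS norm. -/

section ReLU

variable {d : ℕ} {ρ₀ : Measure ((Fin d → ℝ) × ℝ)}

lemma abs_relu_sub_relu_le (s t : ℝ) : |relu s - relu t| ≤ |s - t| := by
  simpa [relu] using abs_max_sub_max_le_abs s t 0

lemma abs_sum_mul_le (w x : Fin d → ℝ) : |∑ i, w i * x i| ≤ (∑ i, |w i|) * ‖x‖ := by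
  rw [Finset.sum_mul]
  refine (Finset.abs_sum_le_sum_abs _ _).trans (Finset.sum_le_sum fun i _ => ?_)
  rw [abs_mul]
  exact mul_le_mul_of_nonneg_left (norm_le_pi_norm x i) (abs_nonneg _)

/-- The ReLU features as elements of `L²(ρ₀)`. -/
lemma exists_feature [IsProbabilityMeasure ρ₀] (hρ : ∀ᵐ p ∂ρ₀, (∑ i, |p.1 i|) + |p.2| ≤ 1) :
    ∃ φ : (Fin d → ℝ) → Lp ℝ 2 ρ₀, Continuous φ ∧ (∀ x ∈ cube d, ‖φ x‖ ≤ 1) ∧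
      ∀ a x, potential ρ₀ a x = inner ℝ (φ x) a := by
  have hcont (x : Fin d → ℝ) : Continuous fun p : (Fin d → ℝ) × ℝ =>
      relu ((∑ i, p.1 i * x i) + p.2) := by
    unfold relu
    fun_prop
  have hbound (x : Fin d → ℝ) (c : ℝ) (hc : 1 ≤ c) (hx : ‖x‖ ≤ c) :
      ∀ᵐ p ∂ρ₀, ‖relu ((∑ i, p.1 i * x i) + p.2)‖ ≤ c := by
    filter_upwards [hρ] with p hp
    have h1 := abs_relu_sub_relu_le ((∑ i, p.1 i * x i) + p.2) 0
    have h0 : relu 0 = 0 := by simp [relu]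
    rw [h0, sub_zero, sub_zero] at h1
    have hw : 0 ≤ ∑ i, |p.1 i| := Finset.sum_nonneg fun i _ => abs_nonneg _
    rw [Real.norm_eq_abs]
    calc _ ≤ _ := h1
      _ ≤ |∑ i, p.1 i * x i| + |p.2| := abs_add_le _ _
      _ ≤ (∑ i, |p.1 i|) * c + |p.2| * c := by
        refine add_le_add ((abs_sum_mul_le _ _).trans (mul_le_mul_of_nonneg_left hx hw)) ?_
        exact le_mul_of_one_le_right (abs_nonneg _) hc
      _ ≤ c := by
        rw [← add_mul]
        exact mul_le_of_le_one_left (by linarith) hp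
  have hmem (x : Fin d → ℝ) : MemLp (fun p : (Fin d → ℝ) × ℝ =>
      relu ((∑ i, p.1 i * x i) + p.2)) 2 ρ₀ :=
    MemLp.of_bound (hcont x).aestronglyMeasurable (max 1 ‖x‖)
      (hbound x _ (le_max_left _ _) (le_max_right _ _))
  refine ⟨fun x => (hmem x).toLp _, ?_, fun x hx => ?_, fun a x => ?_⟩
  -- The sup norm on x is dual to the ℓ¹ norm on w, so the features are 1-Lipschitz.
  · refine LipschitzWith.continuous (K := 1) (LipschitzWith.of_dist_le_mul fun x y => ?_)
    rw [dist_eq_norm, ← MemLp.toLp_sub, NNReal.coe_one, one_mul, dist_eq_norm]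
    refine (Lp.norm_le_of_ae_bound (C := ‖x - y‖) (norm_nonneg _) ?_).trans (by simp [measureUnivNNReal])
    filter_upwards [MemLp.coeFn_toLp ((hmem x).sub (hmem y)), hρ] with p hp hp1
    rw [hp, Pi.sub_apply, Real.norm_eq_abs]
    refine (abs_relu_sub_relu_le _ _).trans ?_
    rw [add_sub_add_right_eq_sub, ← Finset.sum_sub_distrib]
    simp only [← mul_sub]
    refine (abs_sum_mul_le p.1 (x - y)).trans (mul_le_of_le_one_left (norm_nonneg _) ?_)
    linarith [abs_nonneg p.2]
  · refine (Lp.norm_le_of_ae_bound (C := 1) zero_le_one ?_).trans (by simp [measureUnivNNReal])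
    filter_upwards [MemLp.coeFn_toLp (hmem x), hbound x 1 le_rfl
      ((pi_norm_le_iff_of_nonneg zero_le_one).2 hx)] with p hp hp1
    rwa [hp]
  · rw [potential, L2.inner_def]
    refine integral_congr_ae ?_
    filter_upwards [MemLp.coeFn_toLp (hmem x)] with p hp
    rw [hp]
    simp

/-- The infimum in the RKHS norm is attained. -/
lemma exists_represents_norm_eq {φ : (Fin d → ℝ) → Lp ℝ 2 ρ₀}
    (hpot : ∀ a x, potential ρ₀ a x = inner ℝ (φ x) a) {V : (Fin d → ℝ) → ℝ}
    {a : Lp ℝ 2 ρ₀} (ha : Represents ρ₀ a V) :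
    ∃ b, Represents ρ₀ b V ∧ (rkhsNorm ρ₀ V).toReal = ‖b‖ := by
  -- Evaluations are continuous linear functionals, so the representers form a closed convex set,
  -- and 0 has a nearest point in it.
  have hK : {b | Represents ρ₀ b V} = ⋂ x ∈ cube d, {b | innerSL ℝ (φ x) b = V x} := by
    ext b
    simp [Represents, hpot, eq_comm]
  have hclosed : IsClosed {b | Represents ρ₀ b V} := by
    rw [hK]
    exact isClosed_biInter fun x _ => isClosed_eq (innerSL ℝ (φ x)).continuous continuous_const
  have hconv : Convex ℝ {b | Represents ρ₀ b V} := by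
    rw [hK]
    exact convex_iInter₂ fun x _ =>
      (convex_singleton (V x)).linear_preimage (innerSL ℝ (φ x)).toLinearMap
  obtain ⟨b, hb, hmin⟩ :=
    exists_norm_eq_iInf_of_complete_convex ⟨a, ha⟩ hclosed.isComplete hconv 0
  refine ⟨b, hb, ?_⟩
  have hle (c : Lp ℝ 2 ρ₀) (hc : Represents ρ₀ c V) : ‖b‖ ≤ ‖c‖ := by
    have h := ciInf_le (f := fun w : {b | Represents ρ₀ b V} => ‖0 - (w : Lp ℝ 2 ρ₀)‖)
      ⟨0, by rintro _ ⟨w, rfl⟩; exact norm_nonneg _⟩ ⟨c, hc⟩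
    rw [← hmin] at h
    simpa using h
  have : rkhsNorm ρ₀ V = ‖b‖ₑ := by
    refine le_antisymm (iInf₂_le b hb) (le_iInf₂ fun c hc => ?_)
    rw [enorm_le_iff_norm_le]
    exact hle c hc
  rw [this, toReal_enorm]

end ReLU

/-! ### Choice of the stopping time and conclusion. -/

/-- The rate obtained by early stopping. -/
lemma early_stopping_rate {c₁ c₂ N D n l e T : ℝ} (hc₁ : 0 < c₁) (hN : 0 < N)
    (hD : 1 / 4 ≤ D) (hn : 1 ≤ n) (hl : 1 / 4 ≤ l) (hc₂ : 0 < c₂)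
    (he : e ^ 2 ≤ 32 * √l / √n)
    (hT₁ : c₁ * (N * (n / D) ^ (1 / 4 : ℝ)) ≤ T) (hT₂ : T ≤ c₂ * (N * (n / D) ^ (1 / 4 : ℝ))) :
    0 < T ∧ N ^ 2 / (2 * T) + T * e ^ 2 / 2 ≤
      (1 / c₁ + 32 * c₂) * √l * (N * (D / n) ^ (1 / 4 : ℝ)) := by
  have hD0 : 0 < D := by linarith
  have hn0 : 0 < n := by linarith
  set r := (D / n) ^ (1 / 4 : ℝ) with hr
  have hr0 : 0 < r := Real.rpow_pos_of_pos (by positivity) _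
  have hinv : (n / D) ^ (1 / 4 : ℝ) = r⁻¹ := by
    rw [hr, ← Real.inv_rpow (by positivity), inv_div]
  have hsq : r ^ 2 = √D / √n := by
    rw [hr, ← Real.rpow_natCast, ← Real.rpow_mul (by positivity), ← Real.sqrt_div hD0.le,
      Real.sqrt_eq_rpow]
    norm_num
  have hq : 1 / 2 ≤ √l := Real.le_sqrt_of_sq_le (by linarith)
  have hDq : 1 / 2 ≤ √D := Real.le_sqrt_of_sq_le (by linarith)
  rw [hinv] at hT₁ hT₂
  have hT : 0 < T := lt_of_lt_of_le (by positivity) hT₁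
  refine ⟨hT, ?_⟩
  have h1 : N ^ 2 / (2 * T) ≤ 1 / c₁ * √l * (N * r) := by
    calc N ^ 2 / (2 * T) ≤ N ^ 2 / (2 * (c₁ * (N * r⁻¹))) := by gcongr
      _ = 1 / c₁ * (1 / 2) * (N * r) := by field_simp
      _ ≤ _ := by gcongr
  -- √D ≥ 1/2 buys the factor √D contained in r² at the cost of doubling 32.
  have he' : e ^ 2 ≤ 64 * √l * r ^ 2 := by
    refine he.trans ?_
    rw [hsq, mul_div_assoc', div_le_div_iff_of_pos_right (by positivity)]
    nlinarith
  have h2 : T * e ^ 2 / 2 ≤ 32 * c₂ * √l * (N * r) := by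
    calc T * e ^ 2 / 2 ≤ c₂ * (N * r⁻¹) * (64 * √l * r ^ 2) / 2 := by gcongr
      _ = 32 * c₂ * √l * (N * r) := by field_simp; norm_num
  linarith

theorem mainTheorem2 (c₁ c₂ : ℝ) (hc₁ : 0 < c₁) (hc₂ : c₁ ≤ c₂) :
    ∃ C : ℝ, 0 < C ∧
      ∀ (d n : ℕ), 2 ≤ d → 1 ≤ n →
      ∀ (P : Measure (Fin d → ℝ)) [IsProbabilityMeasure P], (∀ᵐ x ∂P, x ∈ cube d) →
      ∀ (ρ₀ : Measure ((Fin d → ℝ) × ℝ)) [IsProbabilityMeasure ρ₀],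
        (∀ᵐ p ∂ρ₀, (∑ i, |p.1 i|) + |p.2| ≤ 1) →
      ∀ (Vs : (Fin d → ℝ) → ℝ), rkhsNorm ρ₀ Vs < ∞ →
      ∀ (a₀ : Lp ℝ 2 ρ₀) (δ : ℝ), 0 < δ → δ < 1 →
      -- an event of probability at least `1 - δ` for `n` i.i.d. samples of the target `Q_*`
      ∃ E : Set (Fin n → Fin d → ℝ), MeasurableSet E ∧
        ENNReal.ofReal (1 - δ) ≤ Measure.pi (fun _ : Fin n => generated P Vs) E ∧
        ∀ X ∈ E, ∀ a : ℝ → Lp ℝ 2 ρ₀, a 0 = a₀ →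
          IsGradientFlow (empiricalLoss P ρ₀ X) a →
        -- `N` is `‖V_* - V_0‖_H`: the RKHS norm, or just as well `‖a_* - a_0‖` for any
        -- parameter function `a_*` of `V_*`
        ∀ N : ℝ,
          (N = (rkhsNorm ρ₀ (fun x => Vs x - potential ρ₀ a₀ x)).toReal ∨
            ∃ as : Lp ℝ 2 ρ₀, Represents ρ₀ as Vs ∧ N = ‖as - a₀‖) →
        ∀ T : ℝ, c₁ * (N * ((n : ℝ) / Real.log d) ^ (1 / 4 : ℝ)) ≤ T →
          T ≤ c₂ * (N * ((n : ℝ) / Real.log d) ^ (1 / 4 : ℝ)) →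
          InformationTheory.klDiv (generated P Vs) (generated P (potential ρ₀ (a T))) ≤
            ENNReal.ofReal
              (C * √(Real.log (2 / δ)) * (N * (Real.log d / (n : ℝ)) ^ (1 / 4 : ℝ))) := by
  have hc₂0 : 0 < c₂ := hc₁.trans_le hc₂
  refine ⟨1 / c₁ + 32 * c₂, by positivity, ?_⟩
  intro d n hd hn P _ hP ρ₀ _ hρ Vs hVs a₀ δ hδ hδ1
  obtain ⟨φ, hφc, hφ1, hpot⟩ := exists_feature hρ
  have hφ : StronglyMeasurable φ := hφc.stronglyMeasurable
  have h1 : ∀ᵐ x ∂P, ‖φ x‖ ≤ 1 := hP.mono hφ1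
  have hgen (a : Lp ℝ 2 ρ₀) (ha : Represents ρ₀ a Vs) :
      generated P Vs = P.tilted fun x => -inner ℝ (φ x) a := by
    refine tilted_congr ?_
    filter_upwards [hP] with x hx
    rw [ha x hx, hpot]
  obtain ⟨ar, har⟩ : ∃ a, Represents ρ₀ a Vs := by
    simp only [rkhsNorm, iInf_lt_iff] at hVs
    obtain ⟨a, ha, -⟩ := hVs
    exact ⟨a, ha⟩
  have hprob : IsProbabilityMeasure (generated P Vs) := by
    rw [hgen ar har]
    exact isProbabilityMeasure_tilted (integrable_exp_of_abs_le
      (hφ.inner stronglyMeasurable_const).neg.aestronglyMeasurable (ae_abs_neg_inner_le h1 ar))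
  have h1' : ∀ᵐ x ∂(generated P Vs), ‖φ x‖ ≤ 1 := tilted_absolutelyContinuous _ _ h1
  -- The bad event depends on Q_* only, so one event serves every representer a_*.
  set S := {x : Fin n → Fin d → ℝ | 32 * √(Real.log (2 / δ)) / √n <
    ‖(n : ℝ)⁻¹ • ∑ i, φ (x i) - ∫ y, φ y ∂(generated P Vs)‖ ^ 2}
  have hS : MeasurableSet S := by
    refine (isOpen_lt continuous_const ?_).measurableSet
    fun_prop
  have hSδ := measure_norm_empirical_sub_mean_sq_gt_le hφ h1' hn hδ hδ1
  refine ⟨Sᶜ, hS.compl, ?_, ?_⟩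
  · rw [prob_compl_eq_one_sub hS, ENNReal.ofReal_sub _ hδ.le, ENNReal.ofReal_one]
    exact tsub_le_tsub_left hSδ _
  intro X hX a ha0 hflow
  have hX : ‖(n : ℝ)⁻¹ • ∑ i, φ (X i) - ∫ y, φ y ∂(generated P Vs)‖ ^ 2 ≤
    32 * √(Real.log (2 / δ)) / √n := not_lt.1 hX
  have hloss : empiricalLoss P ρ₀ X = fun a => inner ℝ ((n : ℝ)⁻¹ • ∑ i, φ (X i)) a +
      Real.log (∫ x, Real.exp (-inner ℝ (φ x) a) ∂P) := by
    funext b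
    simp only [empiricalLoss, hpot, real_inner_smul_left, sum_inner]
    ring
  rw [hloss] at hflow
  have main (as : Lp ℝ 2 ρ₀) (has : Represents ρ₀ as Vs) (T : ℝ)
      (hT₁ : c₁ * (‖as - a₀‖ * ((n : ℝ) / Real.log d) ^ (1 / 4 : ℝ)) ≤ T)
      (hT₂ : T ≤ c₂ * (‖as - a₀‖ * ((n : ℝ) / Real.log d) ^ (1 / 4 : ℝ))) :
      InformationTheory.klDiv (generated P Vs) (generated P (potential ρ₀ (a T))) ≤
        ENNReal.ofReal ((1 / c₁ + 32 * c₂) * √(Real.log (2 / δ)) *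
          (‖as - a₀‖ * (Real.log d / (n : ℝ)) ^ (1 / 4 : ℝ))) := by
    have hgenT : generated P (potential ρ₀ (a T)) =
        P.tilted fun x => -inner ℝ (φ x) (a T) := by
      simp only [generated, hpot]
    rw [hgen as has] at hX ⊢
    rw [hgenT]
    -- If a_* = a_0 the window forces T = 0, and the flow is still at the target.
    rcases (norm_nonneg (as - a₀)).eq_or_lt with h | hN
    · simp only [← h, zero_mul, mul_zero] at hT₁ hT₂
      have hprob' := hgen as has ▸ hprob
      rw [le_antisymm hT₂ hT₁, ha0, sub_eq_zero.1 (norm_eq_zero.1 h.symm),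
        InformationTheory.klDiv_self]
      exact zero_le
    have hlog2 := Real.log_two_gt_d9
    have hd' : Real.log 2 ≤ Real.log d := Real.log_le_log (by norm_num) (by exact_mod_cast hd)
    have hl : Real.log 2 ≤ Real.log (2 / δ) :=
      Real.log_le_log (by norm_num) ((le_div_iff₀ hδ).2 (by linarith))
    obtain ⟨hT, hrate⟩ := early_stopping_rate hc₁ hN (by linarith) (by exact_mod_cast hn)
      (by linarith) hc₂0 hX hT₁ hT₂
    refine (klDiv_gradientFlow_le hφ h1 _ as hflow hT).trans (ENNReal.ofReal_le_ofReal ?_)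
    rwa [ha0]
  rintro N (rfl | ⟨as, has, rfl⟩) T hT₁ hT₂
  -- A norm-minimal representer b of V_* - V_0 yields a_* = b + a_0, reducing the RKHS norm to the
  -- other case.
  · have har' : Represents ρ₀ (ar - a₀) (fun x => Vs x - potential ρ₀ a₀ x) := fun x hx => by
      simp only [har x hx, hpot, inner_sub_right]
    obtain ⟨b, hb, hbn⟩ := exists_represents_norm_eq hpot har'
    have has : Represents ρ₀ (b + a₀) Vs := fun x hx => by
      have := hb x hx
      simp only [hpot, inner_add_right] at this ⊢
      linarith
    have hnorm : ‖b + a₀ - a₀‖ = (rkhsNorm ρ₀ (fun x => Vs x - potential ρ₀ a₀ x)).toReal := by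
      rw [add_sub_cancel_right, hbn]
    rw [← hnorm] at hT₁ hT₂ ⊢
    exact main _ has T hT₁ hT₂
  · exact main as has T hT₁ hT₂
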